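/- A \emph{dimension function} is a non-decreasing continuous function $h:[0,\infty)\to[0,\infty)$ with $h(0)=0$; it is \emph{doubling} if there is a constant $C>0$ such that $h(2x)\le C\,h(x)$ for all $x\ge 0$. For a dimension function $h$ and a set $E\subseteq\mathbb{R}^2$ let $$\mathcal{H}^h(E)=\sup_{\delta>0}\ \inf\Big\{\sum_i h(\operatorname{diam}E_i)\ :\ E\subseteq\bigcup_{i=1}^\infty E_i,\ \operatorname{diam}E_i<\delta\Big\}.$$ For functions $g,f:[0,\infty)\to[0,\infty)$ write $g\prec f$ if $g(x)>0$ for all sufficiently small $x>0$ and $\lim_{x\to0^+} f(x)/g(x)=0$. Given a dimension function $\mathfrak{h}$, a set $E\subseteq\mathbb{R}^2$ (not assumed measurable) is an \emph{$F_{\mathfrak h}$-set} if for every unit vector $e\in\mathbb{R}^2$ there is a line segment $\ell_e$ in the direction of $e$ with $\mathcal{H}^{\mathfrak h}(\ell_e\cap E)>0$. \textbf{Theorem.} Let $\mathfrak{h}$ be a doubling dimension function and let $E$ be an $F_{\mathfrak h}$-set. Let $h$ be a dimension function such that $h\prec\mathfrak{h}^2$. If $$\sum_{k\ge0}\sqrt{k\,\frac{\mathfrak{h}(2^{-k})^2}{h(2^{-k})}}<\infty,$$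 then $\mathcal{H}^h(E)>0$. -/

import Mathlib

open Filter Topology MeasureTheory Set
open scoped NNReal ENNReal

/-- A dimension function: a non-decreasing continuous function from `[0, ∞)` to `[0, ∞)`
that vanishes at `0`. -/
structure IsDimensionFunction (h : ℝ≥0 → ℝ≥0) : Prop where
  monotone : Monotone h
  continuous : Continuous h
  map_zero : h 0 = 0

/-- A doubling dimension function. -/
structure IsDoublingDimensionFunction (h : ℝ≥0 → ℝ≥0) : Prop
    extends IsDimensionFunction h where
  doubling : ∃ C : ℝ≥0, 0 < C ∧ ∀ x : ℝ≥0, h (2 * x) ≤ C * h x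

/-- `g ≺ h`: the quotient `h / g` makes sense near `0` from the right and tends to `0` there.
The first conjunct rules out division by zero. -/
def DimensionallySmaller (g h : ℝ≥0 → ℝ≥0) : Prop :=
  (∀ᶠ x in 𝓝[>] (0 : ℝ≥0), 0 < g x) ∧
    Tendsto (fun x => h x / g x) (𝓝[>] (0 : ℝ≥0)) (𝓝 0)

open Classical in
/-- The generalized Hausdorff (outer) measure of `h`, defined on all subsets of `X`: the supremum
over `δ > 0` of the infimum of `∑ i, h (diam (t i))` over all countable covers by sets `t i` of
diameter at most `δ`. Sets of infinite diameter get the value `∞`, hence play no role. -/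
noncomputable def generalizedHausdorff (X : Type*) [EMetricSpace X] (h : ℝ≥0 → ℝ≥0) :
    OuterMeasure X :=
  OuterMeasure.mkMetric fun d : ℝ≥0∞ => if d = ∞ then ∞ else (h d.toNNReal : ℝ≥0∞)

/-- Furstenberg sets of type `h` in the Euclidean plane: in each direction `e` there is a
(non-degenerate) line segment whose intersection with `E` has positive `h`-measure. -/
def IsFurstenbergSet (h : ℝ≥0 → ℝ≥0) (E : Set (EuclideanSpace ℝ (Fin 2))) : Prop :=
  ∀ e : EuclideanSpace ℝ (Fin 2), ‖e‖ = 1 →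
    ∃ (a : EuclideanSpace ℝ (Fin 2)) (t : ℝ), 0 < t ∧
      0 < generalizedHausdorff (EuclideanSpace ℝ (Fin 2)) h (segment ℝ a (a + t • e) ∩ E)

/-! Suppose the `h`-measure of `E` vanishes. Countable pigeonholing gives a set `S` of slopes in
`[0, 1)`, of positive outer measure, whose lines meet `E` in a set of `𝔥`-content above one fixed
bound at one fixed scale. Cover `E` by sets with tiny total `h`-cost and replace those of diameter
about `2⁻¹ ^ k` by grid squares of that side (`hausdorffAtScale_le_tsum`,
`tsum_encard_levelCells_le`). As the series converges, each line with slope in `S` must, at some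
scale `k`, meet more than a constant times `√(k / h (2⁻¹ ^ k))` of the squares.

Córdoba's `L²` argument (`volume_slopes_le`) bounds the slopes that are this rich at scale `k`: two
lines share few squares unless their slopes are close, at the price of a harmonic sum of size about
`k`. The threshold cancels that `k`, so these slopes have measure at most a constant times the
`h`-cost of level `k`. Summing over `k` makes the measure of `S` smaller than itself. -/

/-! ### Grid squares met by one or two lines -/

/-- The index of the half-open square of side `2 ^ (-k)` that contains the point `(x, y)`. -/
noncomputable def gridCell (k : ℕ) (x y : ℝ) : ℤ × ℤ := (⌊2 ^ k * x⌋, ⌊2 ^ k * y⌋)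

/-- Across one column a line of slope in `[0, 1]` rises by at most one side, so it meets at most two
squares there. -/
theorem card_gridCells_line_le (k : ℕ) {s b u v : ℝ} (hs0 : 0 ≤ s) (hs1 : s ≤ 1) (huv : u ≤ v)
    (S : Finset (ℤ × ℤ)) (hS : ∀ z ∈ S, ∃ x ∈ Icc u v, gridCell k x (s * x + b) = z) :
    (S.card : ℝ) ≤ 2 * (2 ^ k * (v - u) + 2) := by
  have hsub : S ⊆ (Finset.Icc ⌊2 ^ k * u⌋ ⌊2 ^ k * v⌋ ×ˢ ({0, 1} : Finset ℤ)).image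
      fun p => (p.1, ⌊s * p.1 + 2 ^ k * b⌋ + p.2) := by
    intro z hz
    obtain ⟨x, ⟨hux, hxv⟩, rfl⟩ := hS z hz
    have hlo : (⌊2 ^ k * x⌋ : ℝ) ≤ 2 ^ k * x := Int.floor_le _
    have hhi : 2 ^ k * x < ⌊2 ^ k * x⌋ + 1 := Int.lt_floor_add_one _
    have h1 : ⌊s * (⌊2 ^ k * x⌋ : ℝ) + 2 ^ k * b⌋ ≤ ⌊2 ^ k * (s * x + b)⌋ := by
      apply Int.floor_le_floor
      nlinarith
    have h2 : ⌊2 ^ k * (s * x + b)⌋ ≤ ⌊s * (⌊2 ^ k * x⌋ : ℝ) + 2 ^ k * b⌋ + 1 := by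
      rw [← Int.floor_add_one]
      apply Int.floor_le_floor
      nlinarith
    refine Finset.mem_image.2 ⟨(⌊2 ^ k * x⌋,
      ⌊2 ^ k * (s * x + b)⌋ - ⌊s * (⌊2 ^ k * x⌋ : ℝ) + 2 ^ k * b⌋), ?_, ?_⟩
    · rw [Finset.mem_product, Finset.mem_Icc]
      refine ⟨⟨Int.floor_le_floor (by gcongr), Int.floor_le_floor (by gcongr)⟩, ?_⟩
      simp only [Finset.mem_insert, Finset.mem_singleton]
      omega
    · simp [gridCell]
  have hle : S.card ≤ (⌊2 ^ k * v⌋ + 1 - ⌊2 ^ k * u⌋).toNat * 2 := by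
    refine (Finset.card_le_card hsub).trans (Finset.card_image_le.trans ?_)
    rw [Finset.card_product, Int.card_Icc]
    rfl
  have hfl : ⌊2 ^ k * u⌋ ≤ ⌊2 ^ k * v⌋ := Int.floor_le_floor (by gcongr)
  have hcast : (((⌊2 ^ k * v⌋ + 1 - ⌊2 ^ k * u⌋).toNat : ℤ) : ℝ)
      = ⌊2 ^ k * v⌋ + 1 - ⌊2 ^ k * u⌋ := by
    rw [Int.toNat_of_nonneg (by omega)]
    push_cast
    ring
  rw [Int.cast_natCast] at hcast
  have h3 : (S.card : ℝ) ≤ ((⌊2 ^ k * v⌋ + 1 - ⌊2 ^ k * u⌋).toNat : ℝ) * 2 := by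
    exact_mod_cast hle
  rw [hcast] at h3
  have h4 := Int.floor_le ((2 : ℝ) ^ k * v)
  have h5 := Int.lt_floor_add_one ((2 : ℝ) ^ k * u)
  linarith

/-- In a shared square the lines are vertically within two sides of each other: one side for the
height, one for the horizontal offset. This confines the square to a window of half-width `w` around
the abscissa `c` of the crossing point. -/
theorem card_gridCells_two_lines_le (k : ℕ) {s b s' b' : ℝ} (hs0 : 0 ≤ s) (hs1 : s ≤ 1)
    (hs0' : 0 ≤ s') (hs1' : s' ≤ 1) (hne : s ≠ s') (S : Finset (ℤ × ℤ))
    (hS : ∀ z ∈ S, ∃ x, gridCell k x (s * x + b) = z)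
    (hS' : ∀ z ∈ S, ∃ x, gridCell k x (s' * x + b') = z) :
    (S.card : ℝ) ≤ 12 / |s - s'| := by
  have hd : 0 < |s - s'| := abs_pos.2 (sub_ne_zero.2 hne)
  have hd1 : |s - s'| ≤ 1 := abs_le.2 ⟨by linarith, by linarith⟩
  have hK : (0 : ℝ) < 2 ^ k := by positivity
  set w : ℝ := 2 / (2 ^ k * |s - s'|) with hw
  have hwpos : 0 < w := by positivity
  set c : ℝ := (b' - b) / (s - s') with hc
  have := card_gridCells_line_le k (b := b) hs0 hs1 (u := c - w) (v := c + w) (by linarith) S ?_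
  · refine this.trans ?_
    have : 2 * (2 ^ k * (c + w - (c - w)) + 2) = 8 / |s - s'| + 4 := by
      rw [hw]
      field_simp
      ring
    rw [this, show (12 : ℝ) = 8 + 4 by norm_num, add_div]
    gcongr
    rw [le_div_iff₀ hd]
    linarith
  · intro z hz
    obtain ⟨x, hx⟩ := hS z hz
    obtain ⟨x', hx'⟩ := hS' z hz
    refine ⟨x, ?_, hx⟩
    have e := hx.trans hx'.symm
    simp only [gridCell, Prod.mk.injEq] at e
    have e1 := Int.abs_sub_lt_one_of_floor_eq_floor e.1
    have e2 := Int.abs_sub_lt_one_of_floor_eq_floor e.2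
    rw [abs_lt] at e1 e2
    have key : |2 ^ k * ((s - s') * x + (b - b'))| ≤ 2 := by
      rw [abs_le]
      constructor <;> nlinarith
    have hxc : (s - s') * x + (b - b') = (s - s') * (x - c) := by
      rw [hc]
      have : s - s' ≠ 0 := sub_ne_zero.2 hne
      field_simp
      ring
    rw [hxc, abs_mul, abs_mul, abs_of_pos hK] at key
    have : |x - c| ≤ w := by
      rw [hw, le_div_iff₀ (by positivity)]
      linarith
    rw [abs_le] at this
    exact ⟨by linarith, by linarith⟩

/-! ### Harmonic sums and Córdoba's `L²` argument -/

theorem sum_range_inv_succ_le (k : ℕ) (hk : 1 ≤ k) :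
    ∑ i ∈ Finset.range (2 ^ k), (1 : ℝ) / (i + 1) ≤ 2 * k := by
  have h := harmonic_le_one_add_log (2 ^ k)
  have e : ((harmonic (2 ^ k) : ℚ) : ℝ) = ∑ i ∈ Finset.range (2 ^ k), (1 : ℝ) / (i + 1) := by
    simp [harmonic]
  rw [← e]
  refine h.trans ?_
  push_cast
  rw [Real.log_pow]
  have : Real.log 2 ≤ 1 := by linarith [Real.log_two_lt_d9]
  have hk' : (1 : ℝ) ≤ k := by exact_mod_cast hk
  nlinarith

theorem sum_inv_abs_sub_le (k : ℕ) (hk : 1 ≤ k) (j : ℕ) (hj : j < 2 ^ k) :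
    ∑ i ∈ Finset.range (2 ^ k), (1 : ℝ) / (|(j : ℝ) - i| + 1) ≤ 4 * k := by
  rw [← Finset.sum_range_add_sum_Ico _ (Nat.succ_le_of_lt hj)]
  have h1 : ∑ i ∈ Finset.range (j + 1), (1 : ℝ) / (|(j : ℝ) - i| + 1)
      ≤ ∑ i ∈ Finset.range (2 ^ k), (1 : ℝ) / (i + 1) := by
    rw [← Finset.sum_range_reflect]
    refine (Finset.sum_le_sum fun i hi => ?_).trans
      (Finset.sum_le_sum_of_subset_of_nonneg (Finset.range_mono (Nat.succ_le_of_lt hj))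
        fun _ _ _ => by positivity)
    rw [Finset.mem_range] at hi
    have : ((j + 1 - 1 - i : ℕ) : ℝ) = j - i := by
      rw [Nat.add_sub_cancel, Nat.cast_sub (by omega)]
    rw [this, sub_sub_cancel, abs_of_nonneg (Nat.cast_nonneg i)]
  have h2 : ∑ i ∈ Finset.Ico (j + 1) (2 ^ k), (1 : ℝ) / (|(j : ℝ) - i| + 1)
      ≤ ∑ i ∈ Finset.range (2 ^ k), (1 : ℝ) / (i + 1) := by
    rw [Finset.sum_Ico_eq_sum_range]
    refine (Finset.sum_le_sum fun i _ => ?_).trans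
      (Finset.sum_le_sum_of_subset_of_nonneg (Finset.range_mono (Nat.sub_le _ (j + 1)))
        fun _ _ _ => by positivity)
    have : (j : ℝ) - ((j + 1 + i : ℕ) : ℝ) = -(1 + i) := by
      push_cast
      ring
    rw [this, abs_neg, abs_of_nonneg (by positivity)]
    gcongr
    linarith
  have h3 := sum_range_inv_succ_le k hk
  have h4 : ∑ i ∈ Finset.range (j + 1), (1 : ℝ) / (|(j : ℝ) - i| + 1)
      + ∑ i ∈ Finset.Ico (j + 1) (2 ^ k), (1 : ℝ) / (|(j : ℝ) - i| + 1) ≤ 4 * k := by linarith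
  exact h4

/-- For equal or adjacent indices the slopes may be arbitrarily close, so only the one-line bound
applies. Otherwise `|i - j| + 1 ≤ 3 * (|i - j| - 1)`, and `36 = 3 * 12` comes from the two-line
bound. -/
theorem card_inter_gridCells_le (k : ℕ) {i j : ℕ} {s b u s' b' : ℝ} (hi : i < 2 ^ k)
    (hj : j < 2 ^ k) (hs : ⌊2 ^ k * s⌋ = i) (hs' : ⌊2 ^ k * s'⌋ = j)
    (S : Finset (ℤ × ℤ)) (hS : ∀ z ∈ S, ∃ x ∈ Icc u (u + 1), gridCell k x (s * x + b) = z)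
    (hS' : ∀ z ∈ S, ∃ x, gridCell k x (s' * x + b') = z) :
    (S.card : ℝ) ≤ 36 * 2 ^ k * (1 / (|(i : ℝ) - j| + 1)) := by
  have hK : (1 : ℝ) ≤ 2 ^ k := one_le_pow₀ (by norm_num)
  have bnd : ∀ {l : ℕ} {r : ℝ}, l < 2 ^ k → ⌊2 ^ k * r⌋ = l →
      (l : ℝ) ≤ 2 ^ k * r ∧ 2 ^ k * r < l + 1 ∧ 0 ≤ r ∧ r ≤ 1 := by
    intro l r hl hr
    rw [Int.floor_eq_iff] at hr
    obtain ⟨h1, h2⟩ := hr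
    rw [Int.cast_natCast] at h1 h2
    have h3 : (l : ℝ) + 1 ≤ 2 ^ k := by exact_mod_cast hl
    have h4 : (0 : ℝ) ≤ l := Nat.cast_nonneg l
    refine ⟨h1, h2, ?_, ?_⟩ <;> nlinarith
  obtain ⟨a1, a2, a3, a4⟩ := bnd hi hs
  obtain ⟨c1, c2, c3, c4⟩ := bnd hj hs'
  rw [mul_one_div, le_div_iff₀ (by positivity)]
  rcases le_or_gt (|(i : ℝ) - j|) 1 with hd | hd
  · have h1 := card_gridCells_line_le k (b := b) a3 a4 (le_add_of_nonneg_right zero_le_one) S hS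
    nlinarith [abs_nonneg ((i : ℝ) - j)]
  · have hd2 : (2 : ℝ) ≤ |(i : ℝ) - j| := by
      have : (1 : ℤ) < |(i : ℤ) - j| := by exact_mod_cast hd
      exact_mod_cast (show (2 : ℤ) ≤ |(i : ℤ) - j| from this)
    have hdist : |(i : ℝ) - j| - 1 ≤ 2 ^ k * |s - s'| := by
      rw [← abs_of_nonneg (show (0 : ℝ) ≤ 2 ^ k by positivity), ← abs_mul]
      have e1 : |(i : ℝ) - j| ≤ |2 ^ k * (s - s')| + 1 := by
        rw [abs_le]
        have := le_abs_self (2 ^ k * (s - s'))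
        have := neg_abs_le (2 ^ k * (s - s'))
        constructor <;> nlinarith
      simpa [abs_mul] using e1
    have hpos : 0 < |s - s'| := by
      by_contra h
      have : |s - s'| = 0 := le_antisymm (not_lt.1 h) (abs_nonneg _)
      rw [this] at hdist
      linarith
    have h1 := card_gridCells_two_lines_le k (b := b) (b' := b') a3 a4 c3 c4
      (sub_ne_zero.1 (abs_pos.1 hpos)) S (fun z hz => (hS z hz).imp fun _ h => h.2) hS'
    rw [le_div_iff₀ hpos] at h1
    have h2 : (0 : ℝ) ≤ S.card := Nat.cast_nonneg _
    calc (S.card : ℝ) * (|(i : ℝ) - j| + 1) ≤ S.card * (3 * (2 ^ k * |s - s'|)) := by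
          gcongr
          linarith
      _ = 3 * 2 ^ k * (S.card * |s - s'|) := by ring
      _ ≤ 3 * 2 ^ k * 12 := by gcongr
      _ = 36 * 2 ^ k := by ring

/-- The `L²` counting argument behind Córdoba's bound for the Kakeya maximal function: lines with
separated slopes, each of which meets at least `N` of the squares in `P`. -/
theorem card_mul_sq_le_of_incident_gridCells (k : ℕ) (hk : 1 ≤ k) (P : Finset (ℤ × ℤ))
    (T : Finset ℕ) (hT : ∀ j ∈ T, j < 2 ^ k) (s b u : ℕ → ℝ)
    (hs : ∀ j ∈ T, ⌊2 ^ k * s j⌋ = j) (R : ℕ → Finset (ℤ × ℤ)) (hRP : ∀ j ∈ T, R j ⊆ P)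
    (hR : ∀ j ∈ T, ∀ z ∈ R j, ∃ x ∈ Icc (u j) (u j + 1), gridCell k x (s j * x + b j) = z)
    {N : ℝ} (hN0 : 0 ≤ N) (hN : ∀ j ∈ T, N ≤ (R j).card) :
    (T.card : ℝ) * N ^ 2 ≤ 144 * k * 2 ^ k * P.card := by
  classical
  have h1 : (T.card : ℝ) * N ≤ ∑ j ∈ T, ((R j).card : ℝ) := by
    rw [← nsmul_eq_mul]
    exact Finset.card_nsmul_le_sum _ _ _ hN
  have h2 : ∑ j ∈ T, ((R j).card : ℝ) = ∑ z ∈ P, ∑ j ∈ T, if z ∈ R j then (1 : ℝ) else 0 := by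
    rw [Finset.sum_comm]
    refine Finset.sum_congr rfl fun j hj => ?_
    rw [Finset.sum_boole, Finset.filter_mem_eq_inter, Finset.inter_eq_right.2 (hRP j hj)]
  have h3 : ∑ z ∈ P, (∑ j ∈ T, if z ∈ R j then (1 : ℝ) else 0) ^ 2
      = ∑ i ∈ T, ∑ j ∈ T, ((R i ∩ R j).card : ℝ) := by
    simp_rw [sq, Finset.sum_mul_sum]
    rw [Finset.sum_comm]
    refine Finset.sum_congr rfl fun i hi => ?_
    rw [Finset.sum_comm]
    refine Finset.sum_congr rfl fun j hj => ?_
    have e : ∀ z, ((if z ∈ R i then (1 : ℝ) else 0) * if z ∈ R j then 1 else 0)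
        = if z ∈ R i ∩ R j then 1 else 0 := by
      intro z
      by_cases h : z ∈ R i <;> by_cases h' : z ∈ R j <;> simp [h, h']
    simp_rw [e]
    rw [Finset.sum_boole, Finset.filter_mem_eq_inter, Finset.inter_eq_right.2
      (Finset.inter_subset_left.trans (hRP i hi))]
  have h4 : ∑ i ∈ T, ∑ j ∈ T, ((R i ∩ R j).card : ℝ) ≤ T.card * (144 * k * 2 ^ k) := by
    rw [← nsmul_eq_mul]
    refine Finset.sum_le_card_nsmul _ _ _ fun i hi => ?_
    calc ∑ j ∈ T, ((R i ∩ R j).card : ℝ)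
        ≤ ∑ j ∈ T, 36 * 2 ^ k * (1 / (|(i : ℝ) - j| + 1)) := by
          refine Finset.sum_le_sum fun j hj => ?_
          refine card_inter_gridCells_le k (b := b i) (u := u i) (b' := b j) (hT i hi) (hT j hj)
            (hs i hi) (hs j hj) _
            (fun z hz => hR i hi z (Finset.mem_inter.1 hz).1)
            (fun z hz => (hR j hj z (Finset.mem_inter.1 hz).2).imp fun _ h => h.2)
      _ ≤ ∑ j ∈ Finset.range (2 ^ k), 36 * 2 ^ k * (1 / (|(i : ℝ) - j| + 1)) :=
          Finset.sum_le_sum_of_subset_of_nonneg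
            (fun j hj => Finset.mem_range.2 (hT j hj)) fun _ _ _ => by positivity
      _ = 36 * 2 ^ k * ∑ j ∈ Finset.range (2 ^ k), 1 / (|(i : ℝ) - j| + 1) := by
          rw [Finset.mul_sum]
      _ ≤ 36 * 2 ^ k * (4 * k) := by
          gcongr
          exact sum_inv_abs_sub_le k hk i (hT i hi)
      _ = 144 * k * 2 ^ k := by ring
  -- Cauchy–Schwarz for the number of lines through each square; its second moment is the sum of
  -- pairwise intersections.
  have h5 := sq_sum_le_card_mul_sum_sq (s := P)
    (f := fun z => ∑ j ∈ T, if z ∈ R j then (1 : ℝ) else 0)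
  rw [h3, ← h2] at h5
  have h6 : ((T.card : ℝ) * N) ^ 2 ≤ P.card * (T.card * (144 * k * 2 ^ k)) :=
    (pow_le_pow_left₀ (by positivity) h1 2).trans (h5.trans (by gcongr))
  rcases T.eq_empty_or_nonempty with rfl | hne
  · simp only [Finset.card_empty, Nat.cast_zero, zero_mul]
    positivity
  · have hpos : (0 : ℝ) < T.card := by exact_mod_cast hne.card_pos
    refine le_of_mul_le_mul_left ?_ hpos
    linarith

/-- A measure bound for the set of slopes `s` for which the line `y = s * x + b s` meets at least
`N` of the squares in `P` above an interval of unit length. -/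
theorem volume_slopes_le (k : ℕ) (hk : 1 ≤ k) (P : Set (ℤ × ℤ)) (hP : P.Finite) (S : Set ℝ)
    (hS : S ⊆ Ico 0 1) (b u : ℝ → ℝ) {N : ℝ} (hN0 : 0 < N)
    (hN : ∀ s ∈ S, ∃ R : Finset (ℤ × ℤ), (∀ z ∈ R, z ∈ P) ∧ N ≤ R.card ∧
      ∀ z ∈ R, ∃ x ∈ Icc (u s) (u s + 1), gridCell k x (s * x + b s) = z) :
    volume S ≤ ENNReal.ofReal (144 * k * hP.toFinset.card / N ^ 2) := by
  classical
  -- One representative slope is kept per dyadic interval meeting `S`. The intervals have length `2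
  -- ^ (-k)`, which cancels the `2 ^ k` in the count.
  set T : Finset ℕ := (Finset.range (2 ^ k)).filter fun j => ∃ s ∈ S, ⌊2 ^ k * s⌋ = (j : ℤ) with hT
  have hTmem : ∀ j ∈ T, j < 2 ^ k ∧ ∃ s ∈ S, ⌊2 ^ k * s⌋ = (j : ℤ) := by
    intro j hj
    simpa [hT] using hj
  have hTS : ∀ j, ∃ s, j ∈ T → s ∈ S ∧ ⌊2 ^ k * s⌋ = (j : ℤ) := by
    intro j
    by_cases hj : j ∈ T
    · obtain ⟨s, hs⟩ := (hTmem j hj).2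
      exact ⟨s, fun _ => hs⟩
    · exact ⟨0, fun h => absurd h hj⟩
  choose s hs using hTS
  have hRex : ∀ j, ∃ R : Finset (ℤ × ℤ), j ∈ T → (∀ z ∈ R, z ∈ P) ∧ N ≤ R.card ∧
      ∀ z ∈ R, ∃ x ∈ Icc (u (s j)) (u (s j) + 1), gridCell k x (s j * x + b (s j)) = z := by
    intro j
    by_cases hj : j ∈ T
    · obtain ⟨R, hR⟩ := hN (s j) (hs j hj).1
      exact ⟨R, fun _ => hR⟩
    · exact ⟨∅, fun h => absurd h hj⟩
  choose R hR using hRex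
  have hcount := card_mul_sq_le_of_incident_gridCells k hk hP.toFinset T
    (fun j hj => (hTmem j hj).1) s (fun j => b (s j)) (fun j => u (s j))
    (fun j hj => (hs j hj).2) R (fun j hj z hz => hP.mem_toFinset.2 ((hR j hj).1 z hz))
    (fun j hj => (hR j hj).2.2) hN0.le (fun j hj => (hR j hj).2.1)
  have hK : (0 : ℝ) < 2 ^ k := by positivity
  have hcov : S ⊆ ⋃ j ∈ T, Ico ((j : ℝ) / 2 ^ k) ((j + 1) / 2 ^ k) := by
    intro r hr
    obtain ⟨h0, h1⟩ := hS hr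
    have hfl0 : 0 ≤ ⌊2 ^ k * r⌋ := Int.floor_nonneg.2 (by positivity)
    obtain ⟨j, hj⟩ := Int.eq_ofNat_of_zero_le hfl0
    have hj' := Int.floor_eq_iff.1 hj
    rw [Int.cast_natCast] at hj'
    refine mem_iUnion₂.2 ⟨j, ?_, ?_, ?_⟩
    · rw [hT, Finset.mem_filter, Finset.mem_range]
      refine ⟨?_, r, hr, hj⟩
      have : (j : ℝ) < 2 ^ k := by nlinarith
      exact_mod_cast this
    · rw [div_le_iff₀ hK]
      linarith
    · rw [lt_div_iff₀ hK]
      linarith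
  calc volume S ≤ ∑ j ∈ T, volume (Ico ((j : ℝ) / 2 ^ k) ((j + 1) / 2 ^ k)) :=
        (measure_mono hcov).trans (measure_biUnion_finset_le _ _)
    _ = ∑ j ∈ T, ENNReal.ofReal (1 / 2 ^ k) := by
        refine Finset.sum_congr rfl fun j _ => ?_
        rw [Real.volume_Ico]
        congr 1
        ring
    _ = ENNReal.ofReal (T.card * (1 / 2 ^ k)) := by
        rw [Finset.sum_const, ← ENNReal.ofReal_nsmul, nsmul_eq_mul]
    _ ≤ _ := by
        apply ENNReal.ofReal_le_ofReal
        rw [mul_one_div, div_le_div_iff₀ hK (by positivity)]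
        linarith

/-! ### Hausdorff content at a fixed scale -/

open Classical in
/-- The extension of a dimension function to extended distances. -/
noncomputable def extendedGauge (h : ℝ≥0 → ℝ≥0) (d : ℝ≥0∞) : ℝ≥0∞ :=
  if d = ∞ then ∞ else (h d.toNNReal : ℝ≥0∞)

theorem extendedGauge_coe (h : ℝ≥0 → ℝ≥0) (d : ℝ≥0) : extendedGauge h d = h d := by
  simp [extendedGauge]

theorem IsDimensionFunction.extendedGauge_zero {h : ℝ≥0 → ℝ≥0} (hh : IsDimensionFunction h) :
    extendedGauge h 0 = 0 := by
  simp [extendedGauge, hh.map_zero]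

theorem IsDimensionFunction.extendedGauge_mono {h : ℝ≥0 → ℝ≥0} (hh : IsDimensionFunction h) :
    Monotone (extendedGauge h) := by
  intro a b hab
  induction b using ENNReal.recTopCoe with
  | top => simp [extendedGauge]
  | coe b =>
    lift a to ℝ≥0 using ne_top_of_le_ne_top ENNReal.coe_ne_top hab
    rw [extendedGauge_coe, extendedGauge_coe]
    exact_mod_cast hh.monotone (by exact_mod_cast hab)

/-- The outer measure at scale `r` from which the Hausdorff measure of `h` is built. -/
noncomputable def hausdorffAtScale (X : Type*) [EMetricSpace X] (h : ℝ≥0 → ℝ≥0) (r : ℝ≥0∞) :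
    OuterMeasure X :=
  OuterMeasure.mkMetric'.pre (fun s => extendedGauge h (Metric.ediam s)) r

theorem generalizedHausdorff_eq_iSup (X : Type*) [EMetricSpace X] (h : ℝ≥0 → ℝ≥0) :
    generalizedHausdorff X h = ⨆ r > 0, hausdorffAtScale X h r := rfl

theorem generalizedHausdorff_pos_iff {X : Type*} [EMetricSpace X] {h : ℝ≥0 → ℝ≥0} {A : Set X} :
    0 < generalizedHausdorff X h A ↔ ∃ r > 0, 0 < hausdorffAtScale X h r A := by
  simp [generalizedHausdorff_eq_iSup, lt_iSup_iff, OuterMeasure.iSup_apply]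

/-- A nonempty set of diameter above `r` would cost `∞`, so none occurs in a cover of finite cost.
Empty sets cost nothing on either side because `h 0 = 0`. -/
theorem exists_cover_of_hausdorffAtScale_lt {X : Type*} [EMetricSpace X] {h : ℝ≥0 → ℝ≥0}
    (hh : IsDimensionFunction h) {r η : ℝ≥0∞} {A : Set X} (hA : hausdorffAtScale X h r A < η) :
    ∃ U : ℕ → Set X, A ⊆ ⋃ i, U i ∧ (∀ i, Metric.ediam (U i) ≤ r) ∧
      ∑' i, extendedGauge h (Metric.ediam (U i)) < η := by
  rw [hausdorffAtScale, OuterMeasure.mkMetric'.pre, OuterMeasure.boundedBy_apply] at hA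
  simp only [iInf_lt_iff] at hA
  obtain ⟨U, hU, hsum⟩ := hA
  have hle : ∀ i, Metric.ediam (U i) ≤ r := by
    intro i
    rcases (U i).eq_empty_or_nonempty with he | hne
    · simp [he]
    by_contra hr
    have := (ENNReal.le_tsum i).trans_lt hsum
    simp [hne, extend, hr] at this
  refine ⟨U, hU, hle, hsum.trans_le' (ENNReal.tsum_le_tsum fun i => ?_)⟩
  rcases (U i).eq_empty_or_nonempty with he | hne
  · simp [he, hh.extendedGauge_zero]
  · simp [hne, extend, hle i]

/-! ### Replacing covers by dyadic squares -/

/-- The index of the square of side `2 ^ (-k)` that contains a point of the plane. -/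
noncomputable def planeCell (k : ℕ) (p : EuclideanSpace ℝ (Fin 2)) : ℤ × ℤ :=
  gridCell k (p 0) (p 1)

theorem ediam_planeCell_preimage_le (k : ℕ) (z : ℤ × ℤ) :
    Metric.ediam (planeCell k ⁻¹' {z}) ≤ ((2 * 2⁻¹ ^ k : ℝ≥0) : ℝ≥0∞) := by
  refine Metric.ediam_le fun p hp q hq => ?_
  rw [edist_le_coe, ← NNReal.coe_le_coe, coe_nndist]
  have e : planeCell k p = planeCell k q := hp.trans hq.symm
  simp only [planeCell, gridCell, Prod.mk.injEq] at e
  have hK : (0 : ℝ) < 2 ^ k := by positivity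
  have bnd : ∀ {x y : ℝ}, ⌊2 ^ k * x⌋ = ⌊2 ^ k * y⌋ → (x - y) ^ 2 ≤ (1 / 2 ^ k) ^ 2 := by
    intro x y h
    have h1 := Int.abs_sub_lt_one_of_floor_eq_floor h
    rw [← mul_sub, abs_mul, abs_of_pos hK] at h1
    rw [sq_le_sq, abs_of_pos (show (0 : ℝ) < 1 / 2 ^ k by positivity), le_div_iff₀ hK]
    linarith
  rw [EuclideanSpace.dist_eq]
  apply Real.sqrt_le_iff.2
  refine ⟨NNReal.coe_nonneg _, ?_⟩
  rw [Fin.sum_univ_two, Real.dist_eq, Real.dist_eq, sq_abs, sq_abs]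
  have h1 := bnd e.1
  have h2 := bnd e.2
  have h3 : (((2 * 2⁻¹ ^ k : ℝ≥0) : ℝ)) ^ 2 = 4 * (1 / 2 ^ k) ^ 2 := by
    push_cast
    rw [mul_pow, inv_pow, one_div]
    norm_num
  rw [h3]
  nlinarith [sq_nonneg ((1 : ℝ) / 2 ^ k)]

/-- Each cell index differs from that of a fixed point by at most two, whence `25 = 5 * 5`. -/
theorem encard_planeCell_image_le (k : ℕ) {U : Set (EuclideanSpace ℝ (Fin 2))}
    (hU : Metric.ediam U ≤ ((2 * 2⁻¹ ^ k : ℝ≥0) : ℝ≥0∞)) : (planeCell k '' U).encard ≤ 25 := by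
  rcases U.eq_empty_or_nonempty with rfl | ⟨q, hq⟩
  · simp
  have hK : (0 : ℝ) < 2 ^ k := by positivity
  set F : Finset (ℤ × ℤ) := Finset.Icc (⌊2 ^ k * q 0⌋ - 2) (⌊2 ^ k * q 0⌋ + 2) ×ˢ
    Finset.Icc (⌊2 ^ k * q 1⌋ - 2) (⌊2 ^ k * q 1⌋ + 2) with hF
  have hsub : planeCell k '' U ⊆ F := by
    rintro _ ⟨p, hp, rfl⟩
    have h1 : edist p q ≤ ((2 * 2⁻¹ ^ k : ℝ≥0) : ℝ≥0∞) :=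
      (Metric.edist_le_ediam_of_mem hp hq).trans hU
    rw [edist_le_coe, ← NNReal.coe_le_coe, coe_nndist, dist_eq_norm] at h1
    have bnd : ∀ i, |2 ^ k * p i - 2 ^ k * q i| ≤ 2 := by
      intro i
      have h2 : |p i - q i| ≤ ‖p - q‖ := PiLp.norm_apply_le (p - q) i
      rw [← mul_sub, abs_mul, abs_of_pos hK]
      have h3 : (((2 * 2⁻¹ ^ k : ℝ≥0) : ℝ)) = 2 / 2 ^ k := by
        push_cast
        rw [inv_pow]
        rfl
      rw [h3] at h1
      have h4 := h2.trans h1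
      rw [le_div_iff₀ hK] at h4
      linarith
    have fl : ∀ {x y : ℝ}, |x - y| ≤ 2 → ⌊x⌋ ∈ Finset.Icc (⌊y⌋ - 2) (⌊y⌋ + 2) := by
      intro x y h
      rw [abs_le] at h
      have h5 : ⌊x⌋ ≤ ⌊y + (2 : ℤ)⌋ := Int.floor_le_floor (by push_cast; linarith)
      have h6 : ⌊y - (2 : ℤ)⌋ ≤ ⌊x⌋ := Int.floor_le_floor (by push_cast; linarith)
      rw [Int.floor_add_intCast] at h5
      rw [Int.floor_sub_intCast] at h6
      exact Finset.mem_Icc.2 ⟨h6, h5⟩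
    exact Finset.mem_coe.2 (Finset.mem_product.2 ⟨fl (bnd 0), fl (bnd 1)⟩)
  refine (encard_le_encard hsub).trans ?_
  rw [encard_coe_eq_coe_finsetCard, hF, Finset.card_product, Int.card_Icc, Int.card_Icc]
  have h7 : ∀ n : ℤ, (n + 2 + 1 - (n - 2)).toNat = 5 := fun n => by omega
  rw [h7, h7]
  norm_num

/-- The members of the family `U` whose diameter is comparable to `2 ^ (-k)`. -/
def dyadicLevel {X : Type*} [EMetricSpace X] (U : ℕ → Set X) (k : ℕ) : Set ℕ :=
  {i | ((2⁻¹ ^ k : ℝ≥0) : ℝ≥0∞) < Metric.ediam (U i) ∧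
    Metric.ediam (U i) ≤ ((2 * 2⁻¹ ^ k : ℝ≥0) : ℝ≥0∞)}

theorem dyadicLevel_unique {X : Type*} [EMetricSpace X] {U : ℕ → Set X} {i k l : ℕ}
    (hk : i ∈ dyadicLevel U k) (hl : i ∈ dyadicLevel U l) : k = l := by
  have key : ∀ {k l : ℕ}, i ∈ dyadicLevel U k → i ∈ dyadicLevel U l → k ≤ l := by
    intro k l hk hl
    by_contra! hlt
    have h1 : (2⁻¹ ^ l : ℝ≥0) < 2 * 2⁻¹ ^ k := by exact_mod_cast hl.1.trans_le hk.2
    obtain ⟨m, rfl⟩ := Nat.exists_eq_add_of_lt hlt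
    have h2 : (2 * 2⁻¹ ^ (l + m + 1) : ℝ≥0) = 2⁻¹ ^ (l + m) := by
      rw [pow_succ]
      field_simp
    rw [h2] at h1
    have h3 : (2⁻¹ ^ (l + m) : ℝ≥0) ≤ 2⁻¹ ^ l :=
      pow_le_pow_of_le_one (by positivity) (by norm_num) (by omega)
    exact absurd h1 (not_lt.2 h3)
  exact le_antisymm (key hk hl) (key hl hk)

theorem exists_mem_dyadicLevel {X : Type*} [EMetricSpace X] {U : ℕ → Set X} {i : ℕ}
    (h0 : Metric.ediam (U i) ≠ 0) (h1 : Metric.ediam (U i) ≤ 1) : ∃ k, i ∈ dyadicLevel U k := by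
  lift Metric.ediam (U i) to ℝ≥0 using ne_top_of_le_ne_top ENNReal.one_ne_top h1 with d hd
  obtain ⟨n, hn1, hn2⟩ := exists_nat_pow_near_of_lt_one (x := d) (y := 2⁻¹)
    (pos_iff_ne_zero.2 (by exact_mod_cast h0)) (by exact_mod_cast h1) (by norm_num)
    (by rw [← NNReal.coe_lt_coe]; norm_num)
  refine ⟨n + 1, ?_, ?_⟩
  · rw [← hd]
    exact_mod_cast hn1
  · rw [← hd]
    have h2 : (2 * 2⁻¹ ^ (n + 1) : ℝ≥0) = 2⁻¹ ^ n := by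
      rw [pow_succ]
      field_simp
    rw [h2]
    exact_mod_cast hn2

/-- The squares of side `2 ^ (-k)` that meet a member of `U` of comparable diameter. -/
noncomputable def levelCells (U : ℕ → Set (EuclideanSpace ℝ (Fin 2))) (k : ℕ) : Set (ℤ × ℤ) :=
  planeCell k '' ⋃ i ∈ dyadicLevel U k, U i

/-- Sets of diameter zero are null because `f 0 = 0`. A square of level `k` meets some `U i` of
diameter above `2⁻¹ ^ k`, so its own diameter is at most twice that of `U i`, hence admissible at
scale `r`. Only squares meeting `A` are counted; for `A` on a line this gives the incidences. -/
theorem hausdorffAtScale_le_tsum {f : ℝ≥0 → ℝ≥0} (hf : IsDimensionFunction f) {r : ℝ≥0∞}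
    {U : ℕ → Set (EuclideanSpace ℝ (Fin 2))} {A : Set (EuclideanSpace ℝ (Fin 2))}
    (hA : A ⊆ ⋃ i, U i) (hU : ∀ i, 2 * Metric.ediam (U i) ≤ r) (hU1 : ∀ i, Metric.ediam (U i) ≤ 1) :
    hausdorffAtScale (EuclideanSpace ℝ (Fin 2)) f r A ≤
      ∑' k, ((levelCells U k ∩ planeCell k '' A).encard : ℝ≥0∞) * f (2 * 2⁻¹ ^ k) := by
  set μ := hausdorffAtScale (EuclideanSpace ℝ (Fin 2)) f r with hμ
  have hsub : A ⊆ (⋃ i ∈ {i | Metric.ediam (U i) = 0}, U i) ∪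
      ⋃ k, ⋃ z : ↥(levelCells U k ∩ planeCell k '' A), planeCell k ⁻¹' {z.1} := by
    intro p hp
    obtain ⟨i, hi⟩ := mem_iUnion.1 (hA hp)
    by_cases h0 : Metric.ediam (U i) = 0
    · exact Or.inl (mem_iUnion₂.2 ⟨i, h0, hi⟩)
    · obtain ⟨k, hk⟩ := exists_mem_dyadicLevel h0 (hU1 i)
      exact Or.inr (mem_iUnion.2 ⟨k, mem_iUnion.2 ⟨⟨planeCell k p,
        ⟨p, mem_iUnion₂.2 ⟨i, hk, hi⟩, rfl⟩, ⟨p, hp, rfl⟩⟩, rfl⟩⟩)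
  have hnull : μ (⋃ i ∈ {i | Metric.ediam (U i) = 0}, U i) = 0 := by
    rw [measure_biUnion_null_iff (to_countable _)]
    intro i hi
    refine le_antisymm ((OuterMeasure.mkMetric'.pre_le ?_).trans ?_) zero_le
    · rw [show Metric.ediam (U i) = 0 from hi]
      exact zero_le
    · rw [show Metric.ediam (U i) = 0 from hi, hf.extendedGauge_zero]
  have hcell : ∀ k, ∀ z : ↥(levelCells U k ∩ planeCell k '' A),
      μ (planeCell k ⁻¹' {z.1}) ≤ f (2 * 2⁻¹ ^ k) := by
    rintro k ⟨z, ⟨p, hp, -⟩, -⟩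
    obtain ⟨i, hi, -⟩ := mem_iUnion₂.1 hp
    refine (OuterMeasure.mkMetric'.pre_le ?_).trans ?_
    · refine (ediam_planeCell_preimage_le k z).trans (le_trans ?_ (hU i))
      rw [ENNReal.coe_mul]
      gcongr
      · exact le_rfl
      · exact hi.1.le
    · rw [← extendedGauge_coe]
      exact hf.extendedGauge_mono (ediam_planeCell_preimage_le k z)
  calc μ A ≤ 0 + ∑' k, ∑' z : ↥(levelCells U k ∩ planeCell k '' A), μ (planeCell k ⁻¹' {z.1}) := by
        refine (measure_mono hsub).trans ((measure_union_le _ _).trans ?_)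
        rw [hnull]
        gcongr
        refine (measure_iUnion_le _).trans (ENNReal.tsum_le_tsum fun k => measure_iUnion_le _)
    _ ≤ ∑' k, ∑' _ : ↥(levelCells U k ∩ planeCell k '' A), (f (2 * 2⁻¹ ^ k) : ℝ≥0∞) := by
        rw [zero_add]
        exact ENNReal.tsum_le_tsum fun k => ENNReal.tsum_le_tsum fun z => hcell k z
    _ = _ := by simp_rw [ENNReal.tsum_set_const]

/-- Each `U i` belongs to at most one level, yields at most 25 squares there, and has diameter above
`2⁻¹ ^ k`, so monotonicity of `h` applies. -/
theorem tsum_encard_levelCells_le {h : ℝ≥0 → ℝ≥0} (hh : IsDimensionFunction h)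
    (U : ℕ → Set (EuclideanSpace ℝ (Fin 2))) :
    ∑' k, ((levelCells U k).encard : ℝ≥0∞) * h (2⁻¹ ^ k) ≤
      25 * ∑' i, extendedGauge h (Metric.ediam (U i)) := by
  have hcard : ∀ k, ((levelCells U k).encard : ℝ≥0∞) ≤
      ∑' i, (dyadicLevel U k).indicator (fun _ => 25) i := by
    intro k
    rw [← Measure.count_apply (MeasurableSet.of_discrete), levelCells, image_iUnion₂,
      ← tsum_subtype]
    refine (measure_biUnion_le _ (to_countable _) _).trans (ENNReal.tsum_le_tsum fun i => ?_)
    rw [Measure.count_apply (MeasurableSet.of_discrete)]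
    exact_mod_cast ENat.toENNReal_le.2 (encard_planeCell_image_le k i.2.2)
  calc ∑' k, ((levelCells U k).encard : ℝ≥0∞) * h (2⁻¹ ^ k)
      ≤ ∑' k, ∑' i, (dyadicLevel U k).indicator (fun _ => (25 : ℝ≥0∞)) i * h (2⁻¹ ^ k) := by
        refine ENNReal.tsum_le_tsum fun k => ?_
        rw [ENNReal.tsum_mul_right]
        gcongr
        exact hcard k
    _ = ∑' i, ∑' k, (dyadicLevel U k).indicator (fun _ => (25 : ℝ≥0∞)) i * h (2⁻¹ ^ k) :=
        ENNReal.tsum_comm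
    _ ≤ ∑' i, 25 * extendedGauge h (Metric.ediam (U i)) := by
        refine ENNReal.tsum_le_tsum fun i => ?_
        by_cases hex : ∃ k, i ∈ dyadicLevel U k
        · obtain ⟨k, hk⟩ := hex
          rw [tsum_eq_single k]
          · rw [indicator_of_mem hk, ← extendedGauge_coe]
            gcongr
            exact hh.extendedGauge_mono hk.1.le
          · intro l hl
            rw [indicator_of_notMem fun h' => hl (dyadicLevel_unique h' hk), zero_mul]
        · push Not at hex
          simp [indicator_of_notMem (hex _)]
    _ = _ := ENNReal.tsum_mul_left

/-! ### Slopes of a Furstenberg set and the contradiction -/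

/-- The part of the line `y = s * x + b` above the interval `[m, m + 1]`. -/
def lineStrip (s b m : ℝ) : Set (EuclideanSpace ℝ (Fin 2)) :=
  {p | p 1 = s * p 0 + b ∧ p 0 ∈ Icc m (m + 1)}

/-- Countably many unit strips cover the line, so one of them has positive measure. A single integer
`n` encodes both scale and lower bound, ready for pigeonholing over slopes. -/
theorem IsFurstenbergSet.exists_lineStrip {f : ℝ≥0 → ℝ≥0} {E : Set (EuclideanSpace ℝ (Fin 2))}
    (hE : IsFurstenbergSet f E) (s : ℝ) : ∃ (b m : ℝ) (n : ℕ), (n : ℝ≥0∞)⁻¹ <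
      hausdorffAtScale (EuclideanSpace ℝ (Fin 2)) f (n : ℝ≥0∞)⁻¹ (lineStrip s b m ∩ E) := by
  set q : ℝ := √(1 + s ^ 2) with hq
  have hqpos : 0 < q := Real.sqrt_pos.2 (by positivity)
  have hq2 : q ^ 2 = 1 + s ^ 2 := Real.sq_sqrt (by positivity)
  obtain ⟨a, t, -, hpos⟩ := hE !₂[1 / q, s / q] (by
    rw [EuclideanSpace.norm_eq, Real.sqrt_eq_one, Fin.sum_univ_two]
    simp only [Real.norm_eq_abs, sq_abs, Matrix.cons_val_zero, Matrix.cons_val_one]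
    rw [div_pow, div_pow, ← add_div, one_pow, ← hq2, div_self (by positivity)])
  set b : ℝ := a 1 - s * a 0 with hb
  have hsub : segment ℝ a (a + t • !₂[1 / q, s / q]) ∩ E ⊆ ⋃ m : ℤ, lineStrip s b m ∩ E := by
    rintro p ⟨hp, hpE⟩
    refine mem_iUnion.2 ⟨⌊p 0⌋, ⟨?_, Int.floor_le _, (Int.lt_floor_add_one _).le⟩, hpE⟩
    rw [segment_eq_image'] at hp
    obtain ⟨θ, -, rfl⟩ := hp
    simp only [add_sub_cancel_left, PiLp.add_apply, PiLp.smul_apply, smul_eq_mul,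
      Matrix.cons_val_zero, Matrix.cons_val_one, hb]
    ring
  obtain ⟨m, hm⟩ : ∃ m : ℤ, 0 < generalizedHausdorff _ f (lineStrip s b m ∩ E) := by
    by_contra! hcon
    refine hpos.ne' (le_antisymm ((measure_mono hsub).trans ?_) zero_le)
    rw [measure_iUnion_null fun m => le_antisymm (hcon m) zero_le]
  obtain ⟨r, hr, hm⟩ := generalizedHausdorff_pos_iff.1 hm
  obtain ⟨n, hn⟩ := ENNReal.exists_inv_nat_lt (lt_min hr hm).ne'
  exact ⟨b, m, n, (hn.trans_le (min_le_right _ _)).trans_le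
    (OuterMeasure.mkMetric'.mono_pre _ (hn.le.trans (min_le_left _ _)) _)⟩

theorem DimensionallySmaller.pos {g f : ℝ≥0 → ℝ≥0} (h : DimensionallySmaller g f)
    (hg : IsDimensionFunction g) {x : ℝ≥0} (hx : 0 < x) : 0 < g x := by
  obtain ⟨y, hy, hyx⟩ := (h.1.and (Ioo_mem_nhdsGT hx)).exists
  exact hy.trans_le (hg.monotone hyx.2.le)

theorem levelCells_zero {U : ℕ → Set (EuclideanSpace ℝ (Fin 2))}
    (hU : ∀ i, Metric.ediam (U i) ≤ 1) : levelCells U 0 = ∅ := by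
  have : dyadicLevel U 0 = ∅ := by
    ext i
    simpa [dyadicLevel] using fun h => absurd h (not_lt.2 (hU i))
  simp [levelCells, this]

theorem mainTheorem1 (𝔥 h : ℝ≥0 → ℝ≥0) (E : Set (EuclideanSpace ℝ (Fin 2)))
    (h𝔥 : IsDoublingDimensionFunction 𝔥) (hE : IsFurstenbergSet 𝔥 E)
    (hh : IsDimensionFunction h)
    (hlt : DimensionallySmaller h (fun x => 𝔥 x ^ 2))
    (hsum : Summable fun k : ℕ =>
      Real.sqrt ((k : ℝ) * ((𝔥 ((2 : ℝ≥0)⁻¹ ^ k) : ℝ) ^ 2 / (h ((2 : ℝ≥0)⁻¹ ^ k) : ℝ)))) :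
    0 < generalizedHausdorff (EuclideanSpace ℝ (Fin 2)) h E := by
  by_contra hcon
  choose b m n hbmn using hE.exists_lineStrip
  obtain ⟨C, hC, hdoub⟩ := h𝔥.doubling
  have hh0 : ∀ k : ℕ, 0 < h (2⁻¹ ^ k) := fun k => hlt.pos hh (by positivity)
  -- a set of slopes of positive measure on which the lower bound is uniform
  obtain ⟨n₀, hn₀⟩ : ∃ n₀ : ℕ, 0 < volume {s ∈ Ico (0 : ℝ) 1 | n s = n₀} := by
    refine exists_measure_pos_of_not_measure_iUnion_null fun h0 => ?_
    have hsub : Ico (0 : ℝ) 1 ⊆ ⋃ n₀ : ℕ, {s ∈ Ico (0 : ℝ) 1 | n s = n₀} :=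
      fun s hs => mem_iUnion.2 ⟨n s, hs, rfl⟩
    have := measure_mono_null hsub h0
    simp at this
  set S : Set ℝ := {s ∈ Ico (0 : ℝ) 1 | n s = n₀} with hS
  have hSlt : ∀ s ∈ S, (n₀ : ℝ≥0∞)⁻¹ <
      hausdorffAtScale (EuclideanSpace ℝ (Fin 2)) 𝔥 (n₀ : ℝ≥0∞)⁻¹ (lineStrip s (b s) (m s) ∩ E) := by
    rintro s ⟨-, hs⟩
    rw [← hs]
    exact hbmn s
  have hn₀pos : 0 < n₀ := by
    rw [pos_iff_ne_zero]
    rintro rfl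
    obtain ⟨s, hs⟩ := nonempty_of_measure_ne_zero hn₀.ne'
    simpa using hSlt s hs
  set a : ℕ → ℝ := fun k : ℕ =>
    √((k : ℝ) * ((𝔥 ((2 : ℝ≥0)⁻¹ ^ k) : ℝ) ^ 2 / (h ((2 : ℝ≥0)⁻¹ ^ k) : ℝ))) with ha
  have ha0 : ∀ k, 0 ≤ a k := fun k => Real.sqrt_nonneg _
  -- Chosen so that `∑' k, c * a k ≤ 1 / n₀`; the `+ 1` avoids a zero denominator.
  set c : ℝ := 1 / (n₀ * (∑' k, a k + 1)) with hc
  have htsum : 0 ≤ ∑' k, a k := tsum_nonneg ha0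
  have hn₀R : (0 : ℝ) < n₀ := by exact_mod_cast hn₀pos
  have hcpos : 0 < c := by positivity
  have hCR : (0 : ℝ) < C := hC
  set κ : ℝ := c / C with hκ
  have hκpos : 0 < κ := by positivity
  -- This threshold serves two ends: `N k * (C * 𝔥 (2⁻¹ ^ k)) = c * a k`, where `C` pays for squares
  -- of diameter up to `2 * 2⁻¹ ^ k`, and `k / N k ^ 2 = h (2⁻¹ ^ k) / κ ^ 2` for `k ≥ 1`.
  set N : ℕ → ℝ := fun k => κ * √(k / h (2⁻¹ ^ k)) with hN
  -- an efficient cover of `E` by small sets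
  set B : ℝ≥0∞ := ENNReal.ofReal (144 / κ ^ 2) * 25 with hB
  -- Halving the scale leaves room for squares of up to twice the diameter of the covering sets.
  obtain ⟨U, hEU, hUd, hUsum⟩ : ∃ U : ℕ → Set (EuclideanSpace ℝ (Fin 2)), E ⊆ ⋃ i, U i ∧
      (∀ i, Metric.ediam (U i) ≤ (n₀ : ℝ≥0∞)⁻¹ / 2) ∧
      ∑' i, extendedGauge h (Metric.ediam (U i)) < volume S / B := by
    refine exists_cover_of_hausdorffAtScale_lt hh (lt_of_le_of_lt (b := 0) ?_ ?_)
    · by_contra hpos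
      refine hcon (generalizedHausdorff_pos_iff.2 ⟨(n₀ : ℝ≥0∞)⁻¹ / 2, ?_, not_le.1 hpos⟩)
      exact ENNReal.div_pos (by simp) (by simp)
    · exact ENNReal.div_pos hn₀.ne' (ENNReal.mul_ne_top ENNReal.ofReal_ne_top (by simp))
  have hU2 : ∀ i, 2 * Metric.ediam (U i) ≤ (n₀ : ℝ≥0∞)⁻¹ := by
    intro i
    calc 2 * Metric.ediam (U i) ≤ 2 * ((n₀ : ℝ≥0∞)⁻¹ / 2) := by gcongr; exact hUd i
      _ = _ := ENNReal.mul_div_cancel (by simp) (by simp)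
  have hU1 : ∀ i, Metric.ediam (U i) ≤ 1 := by
    intro i
    refine (hUd i).trans (ENNReal.half_le_self.trans (ENNReal.inv_le_one.2 ?_))
    exact_mod_cast hn₀pos
  have hcells := tsum_encard_levelCells_le hh U
  have hfin : ∀ k, (levelCells U k).Finite := by
    intro k
    rw [← encard_ne_top_iff]
    intro htop
    have h1 := (ENNReal.le_tsum k).trans hcells
    rw [htop, ENat.toENNReal_top, ENNReal.top_mul (by exact_mod_cast (hh0 k).ne'), top_le_iff] at h1
    exact ENNReal.mul_ne_top (by simp) (ne_top_of_lt hUsum) h1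
  set R : ℕ → ℝ → Set (ℤ × ℤ) := fun k s =>
    levelCells U k ∩ planeCell k '' (lineStrip s (b s) (m s) ∩ E) with hR
  have hRfin : ∀ k s, (R k s).Finite := fun k s => (hfin k).subset inter_subset_left
  -- each slope is good at some scale
  have hScov : S ⊆ ⋃ k, {s ∈ S | 1 ≤ k ∧ N k < (hRfin k s).toFinset.card} := by
    intro s hs
    obtain ⟨k, hk⟩ : ∃ k, N k < (hRfin k s).toFinset.card := by
      by_contra! hle
      have hterm : ∀ k, ((R k s).encard : ℝ≥0∞) * 𝔥 (2 * 2⁻¹ ^ k) ≤ ENNReal.ofReal (c * a k) := by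
        intro k
        have h1 : ((R k s).encard : ℝ≥0∞) = ENNReal.ofReal (hRfin k s).toFinset.card := by
          rw [(hRfin k s).encard_eq_coe_toFinset_card, ENNReal.ofReal_natCast]
          simp
        have h2 : (𝔥 (2 * 2⁻¹ ^ k) : ℝ) ≤ C * 𝔥 (2⁻¹ ^ k) := by exact_mod_cast hdoub (2⁻¹ ^ k)
        rw [h1, ← ENNReal.ofReal_coe_nnreal, ← ENNReal.ofReal_mul (Nat.cast_nonneg _)]
        apply ENNReal.ofReal_le_ofReal
        calc ((hRfin k s).toFinset.card : ℝ) * 𝔥 (2 * 2⁻¹ ^ k)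
            ≤ N k * (C * 𝔥 (2⁻¹ ^ k)) :=
              mul_le_mul (hle k) h2 (NNReal.coe_nonneg _) (by positivity)
          _ = c * a k := by
              simp only [hN, ha, hκ]
              rw [mul_div_assoc', mul_comm (k : ℝ), mul_div_assoc,
                Real.sqrt_mul (sq_nonneg _), Real.sqrt_sq (NNReal.coe_nonneg _)]
              field_simp
      have h3 := (hSlt s hs).trans_le (hausdorffAtScale_le_tsum h𝔥.toIsDimensionFunction
        (inter_subset_right.trans hEU) hU2 hU1)
      refine absurd h3 (not_lt.2 ((ENNReal.tsum_le_tsum hterm).trans ?_))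
      rw [← ENNReal.ofReal_tsum_of_nonneg (fun k => mul_nonneg hcpos.le (ha0 k))
        (hsum.mul_left c), tsum_mul_left, ← ENNReal.ofReal_natCast,
        ← ENNReal.ofReal_inv_of_pos hn₀R]
      apply ENNReal.ofReal_le_ofReal
      rw [hc, one_div, mul_inv, mul_assoc]
      refine mul_le_of_le_one_right (by positivity) ?_
      rw [inv_mul_le_one₀ (by positivity)]
      linarith
    refine mem_iUnion.2 ⟨k, hs, Nat.one_le_iff_ne_zero.2 ?_, hk⟩
    -- At `k = 0` the threshold is zero, but level 0 needs diameters above 1 and so has no squares.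
    rintro rfl
    simp [hN, hR, levelCells_zero hU1] at hk
  have hvol : ∀ k, volume {s ∈ S | 1 ≤ k ∧ N k < (hRfin k s).toFinset.card} ≤
      ENNReal.ofReal (144 / κ ^ 2) * ((levelCells U k).encard * h (2⁻¹ ^ k)) := by
    intro k
    rcases Nat.eq_zero_or_pos k with rfl | hk
    · simp
    have hkR : (0 : ℝ) < k := by exact_mod_cast hk
    have hhR : (0 : ℝ) < h (2⁻¹ ^ k) := hh0 k
    have hNpos : 0 < N k := by positivity
    refine (volume_slopes_le k hk (levelCells U k) (hfin k) _ (fun s hs => hs.1.1) b m hNpos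
      fun s hs => ⟨(hRfin k s).toFinset, fun z hz => ((hRfin k s).mem_toFinset.1 hz).1,
        hs.2.2.le, fun z hz => ?_⟩).trans_eq ?_
    · obtain ⟨-, p, ⟨⟨hp1, hp0⟩, -⟩, rfl⟩ := (hRfin k s).mem_toFinset.1 hz
      exact ⟨p 0, hp0, by rw [planeCell, hp1]⟩
    · have h1 : ((levelCells U k).encard : ℝ≥0∞) = ENNReal.ofReal (hfin k).toFinset.card := by
        rw [(hfin k).encard_eq_coe_toFinset_card, ENNReal.ofReal_natCast]
        simp
      rw [h1, ← ENNReal.ofReal_coe_nnreal, ← ENNReal.ofReal_mul (Nat.cast_nonneg _),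
        ← ENNReal.ofReal_mul (by positivity)]
      congr 1
      simp only [hN]
      rw [mul_pow, Real.sq_sqrt (by positivity)]
      field_simp
  have hle : volume S ≤ (∑' i, extendedGauge h (Metric.ediam (U i))) * B := by
    calc volume S ≤ ∑' k, volume {s ∈ S | 1 ≤ k ∧ N k < (hRfin k s).toFinset.card} :=
          (measure_mono hScov).trans (measure_iUnion_le _)
      _ ≤ ∑' k, ENNReal.ofReal (144 / κ ^ 2) * ((levelCells U k).encard * h (2⁻¹ ^ k)) :=
          ENNReal.tsum_le_tsum hvol
      _ = ENNReal.ofReal (144 / κ ^ 2) * ∑' k, ((levelCells U k).encard * h (2⁻¹ ^ k) : ℝ≥0∞) :=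
          ENNReal.tsum_mul_left
      _ ≤ ENNReal.ofReal (144 / κ ^ 2) *
          (25 * ∑' i, extendedGauge h (Metric.ediam (U i))) := by gcongr
      _ = _ := by rw [hB]; ring
  exact absurd (ENNReal.mul_lt_of_lt_div hUsum) (not_lt.2 hle)
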